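/- Let $(X_n)_{n\ge 1}$ be independent, identically distributed real random variables on a probability space, with common law that of $X$. Suppose that $X$ is symmetric ($-X$ has the same law as $X$) and non-lattice (there are no $a\in\mathbb{R}$ and $d>0$ with $\mathbb{P}[X\in a+d\mathbb{Z}]=1$). Let $0<p\le 2$ and let $(b_n)_{n\ge1}$ be positive real numbers such that $\frac{X_1+\cdots+X_n}{b_n}$ converges in law to the probability distribution with characteristic function $t\mapsto\exp(-|t|^p)$. Put $c_p=\frac{1}{2\pi}\int_{-\infty}^{+\infty}\exp(-|t|^p)\,dt$, and let $m$ be Lebesgue measure on $\mathbb{R}$. Then for every bounded Jordan-measurable Borel set $B\subset\mathbb{R}$ (that is, bounded, Borel, with $m(\partial B)=0$), $$\lim_{n\to+\infty} b_n\,\mathbb{P}[X_1+\cdots+X_n\in B]=c_p\,m(B).$$ Moreover, for every sequence $(\tau_n)_{n\ge 1}$ of positive real numbers with $\tau_n\to+\infty$ and $b_n/\tau_n\to+\infty$, and every such $B$, $$\lim_{n\to+\infty}\frac{b_n}{\tau_n}\,\mathbb{P}\Big[\frac{X_1+\cdots+X_n}{\tau_n}\in B\Big]=c_p\,m(B).$$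 -/

import Mathlib

open MeasureTheory ProbabilityTheory Filter Topology

/-- A law on the real line is lattice if it is carried by an arithmetic progression
`a + d ℤ` with `d > 0` (in particular every Dirac mass is lattice). -/
def IsLatticeLaw (μ : Measure ℝ) : Prop :=
  ∃ a d : ℝ, 0 < d ∧ ∀ᵐ x ∂μ, ∃ k : ℤ, x = a + k * d

/-- Bounded Jordan-measurable subsets of the real line: bounded sets whose topological boundary
is Lebesgue-null. -/
def IsBoundedJordanMeasurable (B : Set ℝ) : Prop :=
  Bornology.IsBounded B ∧ volume (frontier B) = 0

/-- The constant `c_p = (2π)⁻¹ ∫ exp (-|t|^p) dt`. -/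
noncomputable def stableConst (p : ℝ) : ℝ :=
  1 / (2 * Real.pi) * ∫ t : ℝ, Real.exp (-(|t| ^ p))

open scoped NNReal ENNReal BoundedContinuousFunction

/-! The law of `S n / τ n` is tested against `sinc² x * exp (i u x)`, whose Fourier transform is a
translated tent function and so has compact support. Parseval and the substitution `v = s τ n / b n`
turn the rescaled integral into `∫ tent (s τ n / b n - u) φ (s / b n) ^ n ds`. Since `τ n / b n → 0`
and `φ (s / b n) ^ n → exp (-|s| ^ p)`, its limit should be `tent u * ∫ exp (-|s| ^ p)`, which is
`c_p` times the Fourier transform of `sinc² x dx`. Lévy's theorem then gives weak convergence of the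
measures weighted by `sinc²`. Dividing by `sinc²`, bounded below on `[-1, 1]`, and applying the
portmanteau theorem settles sets inside `[-1, 1]`; a dilation settles all bounded sets. The first
assertion is the case `τ = 1`.

The analytic point is the passage to the limit. For `|s| ≤ δ * b n` an integrable majorant comes
from `exists_abs_map_dilation_le`: the limit `exp (-|t| ^ p)` forces `|φ (K u)| ≤ |φ u| ^ 2` for
small `u`, with `K = 4 ^ (1 / p)`, and iteration yields a stretched exponential
(`exists_pow_le_exp`) without any theory of regular variation. For `|s| > δ * b n` the compact
support leaves only frequencies in an annulus, where the non-lattice hypothesis gives `|φ| ≤ ρ < 1`;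
the contribution is `O (b n * ρ ^ n)`, negligible because `b` grows subexponentially
(`tendsto_norming_mul_pow`). -/

/-- The properties of a real characteristic function `φ` and of a norming sequence `b` that are used
in the local limit theorem with symmetric stable limit of index `p`. -/
structure IsStableNorming (φ : ℝ → ℝ) (b : ℕ → ℝ) (p : ℝ) : Prop where
  p_pos : 0 < p
  p_le_two : p ≤ 2
  continuous : Continuous φ
  map_abs : ∀ t, φ |t| = φ t
  map_zero : φ 0 = 1
  abs_le_one : ∀ t, |φ t| ≤ 1
  abs_lt_one : ∀ t, t ≠ 0 → |φ t| < 1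
  pos : ∀ n, 1 ≤ n → 0 < b n
  tendstoUniformlyOn : ∀ A, TendstoUniformlyOn (fun n t => φ (t / b n) ^ n)
    (fun t => Real.exp (-(|t| ^ p))) atTop (Set.Icc (-A) A)

/-! ### Growth of the norming sequence -/

namespace IsStableNorming

variable {φ : ℝ → ℝ} {b : ℕ → ℝ} {p : ℝ}

lemma eventually_abs_sub_lt (h : IsStableNorming φ b p) (A : ℝ) {ε : ℝ} (hε : 0 < ε) :
    ∀ᶠ n in atTop, ∀ t, |t| ≤ A → |φ (t / b n) ^ n - Real.exp (-(|t| ^ p))| < ε := by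
  filter_upwards [Metric.tendstoUniformlyOn_iff.1 (h.tendstoUniformlyOn A) ε hε] with n hn t ht
  have := hn t (abs_le.1 ht)
  rwa [dist_comm, Real.dist_eq] at this

lemma tendsto_pow (h : IsStableNorming φ b p) (t : ℝ) :
    Tendsto (fun n => φ (t / b n) ^ n) atTop (𝓝 (Real.exp (-(|t| ^ p)))) :=
  (h.tendstoUniformlyOn |t|).tendsto_at (abs_le.1 le_rfl)

/-- If `b n` stayed bounded along a subsequence, evaluation at `t = b n` would keep `φ 1 ^ n` away
from zero, against `|φ 1| < 1`. -/
lemma tendsto_norming_atTop (h : IsStableNorming φ b p) : Tendsto b atTop atTop := by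
  by_contra hcon
  simp only [tendsto_atTop, not_forall] at hcon
  obtain ⟨M, hM⟩ := hcon
  have hM' : ∃ᶠ n in atTop, b n ≤ M := by
    rw [not_eventually] at hM
    exact hM.mono fun n hn => (not_le.1 hn).le
  set c := Real.exp (-(|M| ^ p)) with hc
  have hcpos : 0 < c := Real.exp_pos _
  have h1 : Tendsto (fun n => φ 1 ^ n) atTop (𝓝 0) :=
    tendsto_pow_atTop_nhds_zero_of_abs_lt_one (h.abs_lt_one 1 one_ne_zero)
  have h2 := h1.eventually (gt_mem_nhds (half_pos hcpos))
  obtain ⟨n, hnM, hn2, hn3, hn1⟩ := (hM'.and_eventually (h2.and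
    ((h.eventually_abs_sub_lt |M| (half_pos hcpos)).and (eventually_ge_atTop 1)))).exists
  have hb := h.pos n hn1
  have hbM : |b n| ≤ |M| := by rw [abs_of_pos hb]; exact hnM.trans (le_abs_self _)
  have h4 := hn3 (b n) hbM
  rw [div_self hb.ne'] at h4
  have h5 : c ≤ Real.exp (-(|b n| ^ p)) :=
    Real.exp_le_exp.2 (neg_le_neg (Real.rpow_le_rpow (abs_nonneg _) hbM h.p_pos.le))
  have := (abs_lt.1 h4).1
  linarith

/-- A jump of `b` by a factor above `1 + η` would give `φ (1 / b (n + 1)) ^ n` two incompatible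
approximations: `exp (-1)`, from index `n + 1`, and a value at least `exp (-(q ^ p)) > exp (-1)`,
from index `n` at the point `b n / b (n + 1) ≤ q < 1`. -/
lemma eventually_norming_succ_le (h : IsStableNorming φ b p) {η : ℝ} (hη : 0 < η) :
    ∀ᶠ n in atTop, b (n + 1) ≤ (1 + η) * b n := by
  set q : ℝ := (1 + η)⁻¹ with hq
  have hq0 : 0 < q := by positivity
  have hq1 : q < 1 := inv_lt_one_of_one_lt₀ (by linarith)
  set ε : ℝ := (Real.exp (-(q ^ p)) - Real.exp (-1)) / 2 with hε
  have hεpos : 0 < ε := by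
    have : Real.exp (-1) < Real.exp (-(q ^ p)) :=
      Real.exp_lt_exp.2 (neg_lt_neg (Real.rpow_lt_one hq0.le hq1 h.p_pos))
    rw [hε]; linarith
  have h1 : Tendsto (fun n => φ (1 / b (n + 1)) ^ (n + 1)) atTop (𝓝 (Real.exp (-1))) := by
    have := (h.tendsto_pow 1).comp (tendsto_add_atTop_nat 1)
    rwa [abs_one, Real.one_rpow] at this
  have h2 : Tendsto (fun n => φ (1 / b (n + 1))) atTop (𝓝 1) := by
    have hz : Tendsto (fun n => 1 / b (n + 1)) atTop (𝓝 0) :=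
      tendsto_const_nhds.div_atTop (h.tendsto_norming_atTop.comp (tendsto_add_atTop_nat 1))
    have := (h.continuous.tendsto 0).comp hz
    rwa [h.map_zero] at this
  -- Dropping one factor is harmless since `φ (1 / b (n + 1)) → φ 0 = 1`.
  have h3 : Tendsto (fun n => φ (1 / b (n + 1)) ^ n) atTop (𝓝 (Real.exp (-1))) := by
    have := h1.div h2 one_ne_zero
    rw [div_one] at this
    refine this.congr' ?_
    filter_upwards [h2.eventually_ne one_ne_zero] with n hn
    simp only [Pi.div_apply]
    rw [pow_succ, mul_div_cancel_right₀ _ hn]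
  filter_upwards [h3.eventually (gt_mem_nhds (show Real.exp (-1) < Real.exp (-1) + ε by linarith)),
    h.eventually_abs_sub_lt 1 hεpos, eventually_ge_atTop 1] with n hn1 hn2 hn
  by_contra! hcon
  have hb := h.pos n hn
  have hb' := h.pos (n + 1) (by omega)
  have hx0 : 0 < b n / b (n + 1) := div_pos hb hb'
  have hxq : b n / b (n + 1) ≤ q := by
    rw [hq, div_le_iff₀ hb', inv_mul_eq_div, le_div_iff₀ (by positivity)]
    linarith
  have h4 := hn2 (b n / b (n + 1)) (by rw [abs_of_pos hx0]; linarith)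
  have h5 : b n / b (n + 1) / b n = 1 / b (n + 1) := by field_simp
  rw [h5, abs_of_pos hx0] at h4
  have h6 : Real.exp (-(q ^ p)) ≤ Real.exp (-((b n / b (n + 1)) ^ p)) :=
    Real.exp_le_exp.2 (neg_le_neg (Real.rpow_le_rpow hx0.le hxq h.p_pos.le))
  have := (abs_lt.1 h4).1
  linarith

lemma tendsto_norming_mul_pow (h : IsStableNorming φ b p) {ρ : ℝ} (hρ0 : 0 ≤ ρ) (hρ1 : ρ < 1) :
    Tendsto (fun n => b n * ρ ^ n) atTop (𝓝 0) := by
  -- With `η = (1 - ρ) / 2`, consecutive terms have ratio at most `(1 + η) * ρ < 1`.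
  have hr : (1 + (1 - ρ) / 2) * ρ < 1 := by nlinarith
  refine (summable_of_ratio_norm_eventually_le hr ?_).tendsto_atTop_zero
  filter_upwards [h.eventually_norming_succ_le (show 0 < (1 - ρ) / 2 by linarith),
    eventually_ge_atTop 1] with n hn h1
  rw [Real.norm_of_nonneg (mul_nonneg (h.pos _ (by omega)).le (by positivity)),
    Real.norm_of_nonneg (mul_nonneg (h.pos _ h1).le (by positivity)), pow_succ]
  calc b (n + 1) * (ρ ^ n * ρ) ≤ ((1 + (1 - ρ) / 2) * b n) * (ρ ^ n * ρ) := by gcongr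
    _ = _ := by ring

/-- Any small `u` is comparable with `1 / b n` for some large `n`. -/
lemma exists_norming_mul_mem (h : IsStableNorming φ b p) (N : ℕ) :
    ∃ δ > 0, ∀ u, 0 < u → u ≤ δ → ∃ n, N ≤ n ∧ 1 / 2 ≤ u * b n ∧ u * b n ≤ 1 := by
  obtain ⟨N', hN'⟩ := eventually_atTop.1 (h.eventually_norming_succ_le one_pos)
  set N₀ := max N (max N' 1)
  have hb0 := h.pos N₀ (by simp [N₀])
  refine ⟨(b N₀)⁻¹, by positivity, fun u hu hu' => ?_⟩
  have hex : ∃ m, ∀ n, m ≤ n → 1 < u * b n := by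
    have := (h.tendsto_norming_atTop.const_mul_atTop hu).eventually (eventually_gt_atTop 1)
    exact eventually_atTop.1 this
  obtain ⟨m, hm⟩ := hex
  have hN0 : u * b N₀ ≤ 1 := by
    calc u * b N₀ ≤ (b N₀)⁻¹ * b N₀ := by gcongr
      _ = 1 := inv_mul_cancel₀ hb0.ne'
  have hlt : ∀ n, u * b n ≤ 1 → n ≤ m := fun n hn => by
    by_contra! hc
    exact absurd (hm n hc.le) (not_lt.2 hn)
  classical
  -- Take the last `n` with `u * b n ≤ 1`. Then `u * b (n + 1) > 1`, and `b` at most doubles from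
  -- `n` to `n + 1`.
  set n := Nat.findGreatest (fun n => u * b n ≤ 1) m
  have hn1 : u * b n ≤ 1 := Nat.findGreatest_spec (P := fun n => u * b n ≤ 1) (hlt N₀ hN0) hN0
  have hnN : N₀ ≤ n := Nat.le_findGreatest (hlt N₀ hN0) hN0
  have hn2 : 1 < u * b (n + 1) := by
    by_contra! hc
    exact absurd (Nat.le_findGreatest (P := fun n => u * b n ≤ 1) (hlt _ hc) hc)
      (by simp [n])
  have hs := hN' n ((le_max_left _ _).trans ((le_max_right _ _).trans hnN))
  refine ⟨n, (le_max_left _ _).trans hnN, ?_, hn1⟩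
  nlinarith

/-! ### Dilation inequality and stretched exponential bound -/

/-- The dilation factor `4 ^ (1 / p)`, which multiplies the exponent `|t| ^ p` by four. -/
lemma dilation_rpow (hp : 0 < p) : ((4 : ℝ) ^ p⁻¹) ^ p = 4 := by
  rw [← Real.rpow_mul (by norm_num), inv_mul_cancel₀ hp.ne', Real.rpow_one]

lemma dilation_rpow_half (hp : 0 < p) : ((4 : ℝ) ^ p⁻¹) ^ (p / 2) = 2 := by
  rw [← Real.rpow_mul (by norm_num), show p⁻¹ * (p / 2) = 1 / 2 by field_simp,
    ← Real.sqrt_eq_rpow]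
  rw [show (4 : ℝ) = 2 ^ 2 by norm_num]
  exact Real.sqrt_sq (by norm_num)

lemma one_lt_dilation (hp : 0 < p) : 1 < (4 : ℝ) ^ p⁻¹ :=
  Real.one_lt_rpow (by norm_num) (by positivity)

/-- In the limit, dilating by `K` raises `exp (-x)` to the fourth power. Asking only for the square
leaves a margin that absorbs the approximation errors. The index `n` depends on `u`, but taking
`n`-th roots removes it. -/
lemma exists_abs_map_dilation_le (h : IsStableNorming φ b p) :
    ∃ δ > 0, ∀ u, 0 ≤ u → u ≤ δ → |φ ((4 : ℝ) ^ p⁻¹ * u)| ≤ |φ u| ^ 2 := by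
  set K : ℝ := (4 : ℝ) ^ p⁻¹ with hK
  have hK1 : 1 < K := one_lt_dilation h.p_pos
  -- For `1 / 4 ≤ x ≤ 1` the gap `exp (-2x) - exp (-4x)` is at least `4 * ε`; the errors use up at
  -- most `3 * ε`.
  set ε : ℝ := Real.exp (-2) * (1 - Real.exp (-(1 / 2))) / 4 with hε
  have he : Real.exp (-(1 / 2)) < 1 := Real.exp_lt_one_iff.2 (by norm_num)
  have hεpos : 0 < ε := by
    have := Real.exp_pos (-2)
    have : 0 < Real.exp (-2) * (1 - Real.exp (-(1 / 2))) := mul_pos this (by linarith)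
    rw [hε]; linarith
  obtain ⟨N, hN⟩ := eventually_atTop.1 ((h.eventually_abs_sub_lt K hεpos).and
    (eventually_ge_atTop 1))
  obtain ⟨δ, hδ, hδ'⟩ := h.exists_norming_mul_mem N
  refine ⟨δ, hδ, fun u hu huδ => ?_⟩
  rcases hu.eq_or_lt with rfl | hu
  · simp [h.map_zero]
  obtain ⟨n, hnN, hn1, hn2⟩ := hδ' u hu huδ
  have hbn := h.pos n (hN n hnN).2
  set t := u * b n with ht
  have ht0 : 0 < t := by positivity
  have e1 := (hN n hnN).1 t (by rw [abs_of_pos ht0]; linarith)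
  have e2 := (hN n hnN).1 (K * t) (by
    rw [abs_of_pos (by positivity)]; nlinarith)
  rw [show t / b n = u by rw [ht]; field_simp, abs_of_pos ht0] at e1
  rw [show K * t / b n = K * u by rw [ht]; field_simp, abs_of_pos (show 0 < K * t by positivity),
    Real.mul_rpow (by positivity) ht0.le, hK, dilation_rpow h.p_pos, ← hK] at e2
  set x := t ^ p with hx
  have hx1 : x ≤ 1 := Real.rpow_le_one ht0.le hn2 h.p_pos.le
  -- The bound `p ≤ 2` serves here, to make this lower bound independent of `p`.
  have hx4 : 1 / 4 ≤ x := by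
    calc (1 / 4 : ℝ) = (1 / 2 : ℝ) ^ (2 : ℝ) := by norm_num
      _ ≤ (1 / 2 : ℝ) ^ p :=
        Real.rpow_le_rpow_of_exponent_ge (by norm_num) (by norm_num) h.p_le_two
      _ ≤ t ^ p := Real.rpow_le_rpow (by norm_num) hn1 h.p_pos.le
  have k1 : Real.exp (-2) ≤ Real.exp (-x) ^ 2 := by
    rw [← Real.exp_nat_mul]; exact Real.exp_le_exp.2 (by push_cast; linarith)
  have k2 : Real.exp (-(4 * x)) ≤ Real.exp (-x) ^ 2 * Real.exp (-(1 / 2)) := by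
    rw [← Real.exp_nat_mul, ← Real.exp_add]; exact Real.exp_le_exp.2 (by push_cast; linarith)
  have k3 : Real.exp (-x) ≤ 1 := Real.exp_le_one_iff.2 (by linarith)
  have k4 : 4 * ε ≤ Real.exp (-x) ^ 2 - Real.exp (-(4 * x)) := by
    rw [hε]; nlinarith
  have k5 : 0 < Real.exp (-x) := Real.exp_pos _
  have k6 : 0 < Real.exp (-(4 * x)) := Real.exp_pos _
  have k7 : |φ (K * u)| ^ n ≤ (|φ u| ^ 2) ^ n := by
    rw [← abs_pow, ← pow_mul, mul_comm 2 n, pow_mul, ← abs_pow]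
    have a1 := abs_lt.1 e1
    have a2 := abs_lt.1 e2
    have a3 : |φ (K * u) ^ n| ≤ Real.exp (-(4 * x)) + ε := by
      rw [abs_le]; constructor <;> linarith
    have a4 : Real.exp (-x) - ε ≤ |φ u ^ n| := by
      have := le_abs_self (φ u ^ n); linarith
    have a5 : 0 ≤ Real.exp (-x) - ε := by nlinarith
    have a6 := pow_le_pow_left₀ a5 a4 2
    nlinarith
  exact le_of_pow_le_pow_left₀ (Nat.one_le_iff_ne_zero.1 (hN n hnN).2) (by positivity) k7

/-- A stretched exponential bound for the powers of `φ`, uniform in a neighbourhood of zero. -/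
lemma exists_pow_le_exp (h : IsStableNorming φ b p) :
    ∃ δ > 0, ∀ᶠ n in atTop, ∀ s, |s| ≤ δ * b n →
      |φ (s / b n) ^ n| ≤ Real.exp (1 / 4) * Real.exp (-(1 / 4 * |s| ^ (p / 2))) := by
  set K : ℝ := (4 : ℝ) ^ p⁻¹ with hK
  have hK1 : 1 < K := one_lt_dilation h.p_pos
  have hK0 : 0 < K := by linarith
  have hp := h.p_pos
  obtain ⟨δ, hδ, hδ'⟩ := h.exists_abs_map_dilation_le
  refine ⟨δ, hδ, ?_⟩
  -- Base case on `[1, K]`: the limit is at most `exp (-1)`, while `s ^ (p / 2) ≤ 2` keeps the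
  -- target above `exp (-(1 / 2))`.
  have hε : 0 < Real.exp (-(1 / 2)) - Real.exp (-1) :=
    sub_pos.2 (Real.exp_lt_exp.2 (by norm_num))
  filter_upwards [h.eventually_abs_sub_lt K hε, eventually_ge_atTop 1] with n hn hn1
  have hb := h.pos n hn1
  have key : ∀ k : ℕ, ∀ s, 1 ≤ s → s ≤ K ^ (k + 1) → s ≤ δ * b n →
      |φ (s / b n) ^ n| ≤ Real.exp (-(1 / 4 * s ^ (p / 2))) := by
    intro k
    induction k with
    | zero =>
      intro s hs1 hsK _
      rw [zero_add, pow_one] at hsK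
      have h1 := abs_lt.1 (hn s (by rwa [abs_of_pos (by linarith)]))
      rw [abs_of_pos (show 0 < s by linarith)] at h1
      have h2 : Real.exp (-(s ^ p)) ≤ Real.exp (-1) :=
        Real.exp_le_exp.2 (neg_le_neg (Real.one_le_rpow hs1 hp.le))
      have h3 : s ^ (p / 2) ≤ 2 := by
        exact (Real.rpow_le_rpow (by linarith) hsK (by positivity)).trans_eq (dilation_rpow_half hp)
      have h4 : Real.exp (-(1 / 2)) ≤ Real.exp (-(1 / 4 * s ^ (p / 2))) :=
        Real.exp_le_exp.2 (by linarith)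
      have h5 := Real.exp_pos (-(s ^ p))
      have h6 := Real.exp_pos (-1)
      rw [abs_le]; constructor <;> linarith
    | succ k ih =>
      intro s hs1 hsK hsδ
      rcases le_total s (K ^ (k + 1)) with hle | hle
      · exact ih s hs1 hle hsδ
      have hK1' : K ≤ K ^ (k + 1) := le_self_pow₀ hK1.le (by omega)
      have hs0 : 0 < s := by linarith
      have a1 : 1 ≤ s / K := by rw [le_div_iff₀ hK0]; linarith
      have a2 : s / K ≤ K ^ (k + 1) := by
        rw [div_le_iff₀ hK0, ← pow_succ]; exact hsK
      have a3 : s / K ≤ s := div_le_self hs0.le hK1.le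
      have h1 := ih (s / K) a1 a2 (a3.trans hsδ)
      have h2 := hδ' (s / K / b n) (by positivity) (by
        rw [div_le_iff₀ hb]; exact a3.trans hsδ)
      rw [← hK, show K * (s / K / b n) = s / b n by field_simp] at h2
      calc |φ (s / b n) ^ n| = |φ (s / b n)| ^ n := abs_pow _ _
        _ ≤ (|φ (s / K / b n)| ^ 2) ^ n := pow_le_pow_left₀ (abs_nonneg _) h2 n
        _ = |φ (s / K / b n) ^ n| ^ 2 := by rw [abs_pow]; ring
        _ ≤ Real.exp (-(1 / 4 * (s / K) ^ (p / 2))) ^ 2 :=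
          pow_le_pow_left₀ (abs_nonneg _) h1 2
        _ = _ := by
          -- Since `K ^ (p / 2) = 2`, squaring the bound at `s / K` gives exactly the bound at `s`;
          -- this dictates the exponent `p / 2`.
          rw [← Real.exp_nat_mul, Real.div_rpow hs0.le hK0.le, hK, dilation_rpow_half hp]
          congr 1; push_cast; ring
  intro s hs
  have hφ : |φ (s / b n) ^ n| = |φ (|s| / b n) ^ n| := by
    rw [← h.map_abs (s / b n), abs_div, abs_of_pos hb]
  rw [hφ]
  rcases le_total 1 |s| with h1 | h1
  · obtain ⟨k, hk⟩ := pow_unbounded_of_one_lt |s| hK1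
    refine (key k |s| h1 (hk.le.trans (pow_le_pow_right₀ hK1.le (by omega))) hs).trans ?_
    exact le_mul_of_one_le_left (Real.exp_pos _).le (Real.one_le_exp (by norm_num))
  -- The factor `exp (1 / 4)` makes the bound trivial for `|s| ≤ 1`.
  · rw [← Real.exp_add, abs_pow]
    refine (pow_le_one₀ (abs_nonneg _) (h.abs_le_one _)).trans (Real.one_le_exp ?_)
    have := Real.rpow_le_one (abs_nonneg s) h1 (show 0 ≤ p / 2 by positivity)
    linarith

end IsStableNorming

/-! ### Limit of the frequency integrals -/

lemma integrable_exp_neg_mul_abs_rpow {c a : ℝ} (hc : 0 < c) (ha : 0 < a) :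
    Integrable fun s : ℝ => Real.exp (-(c * |s| ^ a)) := by
  have h : IntegrableOn (fun s : ℝ => Real.exp (-(c * |s| ^ a))) (Set.Ioi 0) := by
    have := integrableOn_rpow_mul_exp_neg_mul_rpow (s := 0) (by norm_num) ha hc
    refine this.congr_fun (fun x hx => ?_) measurableSet_Ioi
    simp [abs_of_pos (Set.mem_Ioi.1 hx)]
  rw [← integrableOn_univ, ← Set.Iic_union_Ioi (a := (0 : ℝ)), integrableOn_union]
  refine ⟨?_, h⟩
  rw [integrableOn_Iic_iff_integrableOn_Iio]
  have := h.comp_neg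
  simpa using this

namespace IsStableNorming

variable {φ : ℝ → ℝ} {b : ℕ → ℝ} {p : ℝ}

/-- Compactness makes the pointwise strict inequality `|φ| < 1` uniform. -/
lemma exists_abs_le_of_mem_annulus (h : IsStableNorming φ b p) {δ : ℝ} (hδ : 0 < δ) (A : ℝ) :
    ∃ ρ, 0 ≤ ρ ∧ ρ < 1 ∧ ∀ v, δ ≤ |v| → |v| ≤ A → |φ v| ≤ ρ := by
  set s : Set ℝ := {v | δ ≤ |v|} ∩ Set.Icc (-A) A with hs
  have hcomp : IsCompact s :=
    isCompact_Icc.inter_left (isClosed_le continuous_const continuous_abs)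
  rcases s.eq_empty_or_nonempty with he | hne
  · refine ⟨0, le_rfl, one_pos, fun v h1 h2 => ?_⟩
    have : v ∈ s := ⟨h1, abs_le.1 h2⟩
    simp [he] at this
  · obtain ⟨w, hw, hmax⟩ := hcomp.exists_isMaxOn hne (h.continuous.abs.continuousOn)
    refine ⟨|φ w|, abs_nonneg _, h.abs_lt_one w ?_, fun v h1 h2 => hmax ⟨h1, abs_le.1 h2⟩⟩
    exact abs_pos.1 (hδ.trans_le hw.1)

/-- The contribution of a fixed neighbourhood of the origin, by dominated convergence. -/
lemma tendsto_integral_indicator (h : IsStableNorming φ b p) {G : ℝ → ℝ} (hG : Continuous G)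
    {C : ℝ} (hC : ∀ v, |G v| ≤ C) {r : ℕ → ℝ} (hr : Tendsto r atTop atTop) {δ : ℝ} (hδ : 0 < δ)
    (hbound : ∀ᶠ n in atTop, ∀ s, |s| ≤ δ * b n →
      |φ (s / b n) ^ n| ≤ Real.exp (1 / 4) * Real.exp (-(1 / 4 * |s| ^ (p / 2)))) :
    Tendsto (fun n => ∫ s, {s | |s| ≤ δ * b n}.indicator
      (fun s => G (s / r n) * φ (s / b n) ^ n) s) atTop
      (𝓝 (∫ s, G 0 * Real.exp (-(|s| ^ p)))) := by
  have hC0 : 0 ≤ C := (abs_nonneg _).trans (hC 0)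
  refine tendsto_integral_filter_of_dominated_convergence
    (fun s => C * (Real.exp (1 / 4) * Real.exp (-(1 / 4 * |s| ^ (p / 2))))) ?_ ?_ ?_ ?_
  · refine Eventually.of_forall fun n => ?_
    have hcont : Continuous fun s => G (s / r n) * φ (s / b n) ^ n :=
      (hG.comp (continuous_id.div_const _)).mul ((h.continuous.comp (continuous_id.div_const _)).pow n)
    exact hcont.aestronglyMeasurable.indicator
      (isClosed_le continuous_abs continuous_const).measurableSet
  · filter_upwards [hbound] with n hn
    refine Eventually.of_forall fun s => ?_
    by_cases hs : |s| ≤ δ * b n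
    · rw [Set.indicator_of_mem (by exact hs), Real.norm_eq_abs, abs_mul]
      exact mul_le_mul (hC _) (hn s hs) (abs_nonneg _) hC0
    · rw [Set.indicator_of_notMem (by exact hs), norm_zero]
      positivity
  · exact ((integrable_exp_neg_mul_abs_rpow (by norm_num)
      (half_pos h.p_pos)).const_mul _).const_mul _
  · refine Eventually.of_forall fun s => ?_
    have h1 : Tendsto (fun n => G (s / r n) * φ (s / b n) ^ n) atTop
        (𝓝 (G 0 * Real.exp (-(|s| ^ p)))) :=
      ((hG.tendsto 0).comp (tendsto_const_nhds.div_atTop hr)).mul (h.tendsto_pow s)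
    refine h1.congr' ?_
    filter_upwards [(h.tendsto_norming_atTop.const_mul_atTop hδ).eventually_ge_atTop |s|]
      with n hn
    rw [Set.indicator_of_mem (by exact hn)]

/-- The contribution of the frequencies bounded away from zero is negligible. -/
lemma tendsto_integral_indicator_compl (h : IsStableNorming φ b p) {G : ℝ → ℝ}
    {C : ℝ} (hC : ∀ v, |G v| ≤ C) {A : ℝ} (hA : 0 ≤ A) (hGA : ∀ v, A < |v| → G v = 0)
    {τ : ℕ → ℝ} (hτ : ∀ᶠ n in atTop, 1 ≤ τ n) {δ : ℝ} (hδ : 0 < δ) :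
    Tendsto (fun n => ∫ s, {s | |s| ≤ δ * b n}ᶜ.indicator
      (fun s => G (s / (b n / τ n)) * φ (s / b n) ^ n) s) atTop (𝓝 0) := by
  obtain ⟨ρ, hρ0, hρ1, hρ⟩ := h.exists_abs_le_of_mem_annulus hδ A
  have hC0 : 0 ≤ C := (abs_nonneg _).trans (hC 0)
  have hlim : Tendsto (fun n => C * (2 * A) * (b n * ρ ^ n)) atTop (𝓝 0) := by
    simpa using (h.tendsto_norming_mul_pow hρ0 hρ1).const_mul (C * (2 * A))
  refine squeeze_zero_norm' ?_ hlim
  filter_upwards [hτ, eventually_ge_atTop 1] with n hτn hn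
  have hb := h.pos n hn
  set F : ℝ → ℝ := {s | |s| ≤ δ * b n}ᶜ.indicator
    (fun s => G (s / (b n / τ n)) * φ (s / b n) ^ n) with hF
  have hsupp : ∀ s, s ∉ Set.Icc (-(A * b n)) (A * b n) → F s = 0 := by
    intro s hs
    have hs' : A * b n < |s| := by
      by_contra! hc
      exact hs (abs_le.1 hc)
    -- As `τ n ≥ 1`, the support of `s ↦ G (s * τ n / b n)` lies in `[-A * b n, A * b n]`, so `s / b
    -- n` stays in a fixed annulus.
    have : G (s / (b n / τ n)) = 0 := by
      refine hGA _ ?_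
      rw [div_div_eq_mul_div, abs_div, abs_mul, abs_of_pos hb, abs_of_pos (by linarith : 0 < τ n),
        lt_div_iff₀ hb]
      exact hs'.trans_le (le_mul_of_one_le_right (abs_nonneg _) hτn)
    simp [hF, Set.indicator_apply, this]
  rw [← setIntegral_eq_integral_of_forall_compl_eq_zero hsupp]
  have hle : ∀ s ∈ Set.Icc (-(A * b n)) (A * b n), ‖F s‖ ≤ C * ρ ^ n := by
    intro s hs
    by_cases hs2 : |s| ≤ δ * b n
    · rw [hF, Set.indicator_of_notMem (by simpa using hs2), norm_zero]
      positivity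
    · rw [hF, Set.indicator_of_mem (by exact hs2), Real.norm_eq_abs, abs_mul, abs_pow]
      refine mul_le_mul (hC _) (pow_le_pow_left₀ (abs_nonneg _) (hρ _ ?_ ?_) n)
        (by positivity) hC0
      · rw [abs_div, abs_of_pos hb, le_div_iff₀ hb]
        exact (not_le.1 hs2).le
      · rw [abs_div, abs_of_pos hb, div_le_iff₀ hb]
        exact abs_le.2 hs
  refine (norm_setIntegral_le_of_norm_le_const (by simp) hle).trans_eq ?_
  rw [Real.volume_real_Icc_of_le (by nlinarith [mul_nonneg hA hb.le])]
  ring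

theorem tendsto_integral_mul_pow (h : IsStableNorming φ b p) {G : ℝ → ℝ} (hG : Continuous G)
    {A : ℝ} (hA : 0 ≤ A) (hGA : ∀ v, A < |v| → G v = 0)
    {τ : ℕ → ℝ} (hτ : ∀ᶠ n in atTop, 1 ≤ τ n)
    (hbτ : Tendsto (fun n => b n / τ n) atTop atTop) :
    Tendsto (fun n => ∫ s, G (s / (b n / τ n)) * φ (s / b n) ^ n) atTop
      (𝓝 (G 0 * ∫ s, Real.exp (-(|s| ^ p)))) := by
  have hsupp : HasCompactSupport G := HasCompactSupport.intro (isCompact_Icc (a := -A) (b := A))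
    fun v hv => hGA v (by by_contra! hc; exact hv (abs_le.1 hc))
  obtain ⟨C, hC⟩ := hsupp.exists_bound_of_continuous hG
  obtain ⟨δ, hδ, hbound⟩ := h.exists_pow_le_exp
  have h1 := h.tendsto_integral_indicator hG hC hbτ hδ hbound
  have h2 := h.tendsto_integral_indicator_compl hC hA hGA hτ hδ
  have h3 := h1.add h2
  rw [integral_const_mul, add_zero] at h3
  refine h3.congr' ?_
  filter_upwards [hbτ.eventually_gt_atTop 0] with n hn
  have hms : MeasurableSet {s : ℝ | |s| ≤ δ * b n} :=
    (isClosed_le continuous_abs continuous_const).measurableSet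
  rw [integral_indicator hms, integral_indicator hms.compl, integral_add_compl hms]
  refine Continuous.integrable_of_hasCompactSupport ?_ ?_
  · exact (hG.comp (continuous_id.div_const _)).mul
      ((h.continuous.comp (continuous_id.div_const _)).pow n)
  · refine HasCompactSupport.mul_right ?_
    exact hsupp.comp_homeomorph (Homeomorph.mulRight₀ _ (inv_ne_zero hn.ne'))

end IsStableNorming

/-! ### The tent function and its Fourier transform -/

/-- The tent function with support `[-2, 2]` and integral one. -/
noncomputable def tent (t : ℝ) : ℝ := max 0 (2 - |t|) / 4

lemma continuous_tent : Continuous tent := by unfold tent; fun_prop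

lemma tent_neg (t : ℝ) : tent (-t) = tent t := by simp [tent]

lemma tent_eq_zero {t : ℝ} (ht : 2 ≤ |t|) : tent t = 0 := by
  rw [tent, max_eq_left (by linarith), zero_div]

lemma hasCompactSupport_tent : HasCompactSupport tent :=
  HasCompactSupport.intro (isCompact_Icc (a := -2) (b := 2))
    fun v hv => tent_eq_zero (by by_contra! hc; exact hv (abs_le.1 hc.le))

lemma integrable_tent : Integrable tent :=
  continuous_tent.integrable_of_hasCompactSupport hasCompactSupport_tent

lemma integral_sub_mul_cos (x : ℝ) :
    ∫ t in (0 : ℝ)..2, (2 - t) / 2 * Real.cos (t * x) = Real.sinc x ^ 2 := by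
  rcases eq_or_ne x 0 with rfl | hx
  · have h : ∀ t ∈ Set.uIcc (0 : ℝ) 2, HasDerivAt (fun t : ℝ => t - t ^ 2 / 4)
        ((2 - t) / 2 * Real.cos (t * 0)) t := fun t _ => by
      have := (hasDerivAt_id' t).sub (((hasDerivAt_id' t).pow 2).div_const 4)
      refine this.congr_deriv ?_
      rw [mul_zero, Real.cos_zero]
      push_cast
      ring
    rw [intervalIntegral.integral_eq_sub_of_hasDerivAt h
      (Continuous.intervalIntegrable (by fun_prop) _ _)]
    norm_num
  · have h : ∀ t ∈ Set.uIcc (0 : ℝ) 2, HasDerivAt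
        (fun t : ℝ => (2 - t) / 2 * (Real.sin (t * x) / x) - Real.cos (t * x) / (2 * x ^ 2))
        ((2 - t) / 2 * Real.cos (t * x)) t := fun t _ => by
      have h0 : HasDerivAt (fun t : ℝ => t * x) x t := by
        simpa using (hasDerivAt_id' t).mul_const x
      have h1 := (((hasDerivAt_id' t).const_sub 2).div_const 2).mul (h0.sin.div_const x)
      refine (h1.sub (h0.cos.div_const (2 * x ^ 2))).congr_deriv ?_
      field_simp
      ring
    rw [intervalIntegral.integral_eq_sub_of_hasDerivAt h
      (Continuous.intervalIntegrable (by fun_prop) _ _), Real.sinc_of_ne_zero hx, Real.cos_two_mul']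
    have := Real.sin_sq_add_cos_sq x
    simp only [zero_mul, Real.sin_zero, Real.cos_zero, sub_self, zero_div, mul_zero]
    field_simp
    linear_combination -this

/-- The Fourier transform of the tent function is the square of the cardinal sine. -/
lemma integral_tent_mul_exp (x : ℝ) :
    ∫ t, (tent t : ℂ) * Complex.exp (t * x * Complex.I) = (Real.sinc x ^ 2 : ℝ) := by
  set F : ℝ → ℂ := fun t => (tent t : ℂ) * Complex.exp (t * x * Complex.I) with hF
  have hcont : Continuous F := by
    have := Complex.continuous_ofReal.comp continuous_tent
    exact this.mul (by fun_prop)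
  have h0 : ∫ t, F t = ∫ t in (-2 : ℝ)..2, F t := by
    rw [intervalIntegral.integral_of_le (by norm_num), ← integral_Icc_eq_integral_Ioc,
      setIntegral_eq_integral_of_forall_compl_eq_zero]
    intro t ht
    rw [hF]
    simp only
    rw [tent_eq_zero (by by_contra! hc; exact ht (abs_le.1 hc.le))]
    simp
  have h1 : ∫ t in (-2 : ℝ)..0, F t = ∫ t in (0 : ℝ)..2, F (-t) := by
    rw [intervalIntegral.integral_comp_neg]; simp
  have h2 : ∫ t in (0 : ℝ)..2, (F (-t) + F t) =
      ∫ t in (0 : ℝ)..2, (((2 - t) / 2 * Real.cos (t * x) : ℝ) : ℂ) := by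
    refine intervalIntegral.integral_congr fun t ht => ?_
    rw [Set.uIcc_of_le (by norm_num)] at ht
    have ht' : tent t = (2 - t) / 4 := by
      rw [tent, abs_of_nonneg ht.1, max_eq_right (by linarith [ht.2])]
    simp only [hF, tent_neg, ht']
    push_cast
    rw [Complex.cos]
    simp only [neg_mul]
    ring
  rw [h0, ← intervalIntegral.integral_add_adjacent_intervals (hcont.intervalIntegrable (-2) 0)
    (hcont.intervalIntegrable 0 2), h1, ← intervalIntegral.integral_add
    (Continuous.intervalIntegrable (u := fun t => F (-t)) (hcont.comp continuous_neg) 0 2) (hcont.intervalIntegrable 0 2), h2,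
    intervalIntegral.integral_ofReal, integral_sub_mul_cos]

lemma integrable_sinc_sq : Integrable fun x : ℝ => Real.sinc x ^ 2 := by
  refine (integrable_inv_one_add_sq.const_mul 2).mono'
    (Real.continuous_sinc.pow 2).aestronglyMeasurable (Eventually.of_forall fun x => ?_)
  rw [Real.norm_of_nonneg (sq_nonneg _), ← div_eq_mul_inv, le_div_iff₀ (by positivity)]
  have h1 : Real.sinc x ^ 2 ≤ 1 := (sq_le_one_iff_abs_le_one _).2 (Real.abs_sinc_le_one x)
  have h2 : Real.sinc x ^ 2 * x ^ 2 ≤ 1 := by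
    rcases eq_or_ne x 0 with rfl | hx
    · simp
    · rw [Real.sinc_of_ne_zero hx, div_pow, div_mul_cancel₀ _ (by positivity)]
      exact Real.sin_sq_le_one x
  linarith

/-- Fourier inversion for the tent function. -/
lemma integral_exp_mul_sinc_sq (u : ℝ) :
    ∫ x : ℝ, (Real.sinc x ^ 2 : ℝ) * Complex.exp (u * x * Complex.I) =
      ((2 * Real.pi * tent u : ℝ) : ℂ) := by
  set g : ℝ → ℂ := fun t => (tent t : ℂ) with hg
  have hgc : Continuous g := Complex.continuous_ofReal.comp continuous_tent
  have hgi : Integrable g := integrable_tent.ofReal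
  have hF : FourierTransform.fourier g = fun w : ℝ => ((Real.sinc (2 * Real.pi * w) ^ 2 : ℝ) : ℂ) := by
    ext w
    rw [Real.fourier_real_eq_integral_exp_smul, ← Real.sinc_neg, ← integral_tent_mul_exp]
    refine integral_congr_ae (Eventually.of_forall fun t => ?_)
    simp only [hg, smul_eq_mul]
    rw [mul_comm]
    congr 3
    push_cast
    ring
  have hpi : (2 * Real.pi) ≠ 0 := by positivity
  have hFi : Integrable (FourierTransform.fourier g) := by
    rw [hF]
    exact (integrable_sinc_sq.comp_mul_left' hpi).ofReal
  have hinv := congrFun (hgc.fourierInv_fourier_eq hgi hFi) u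
  rw [hF, Real.fourierInv_eq'] at hinv
  have hsub := Measure.integral_comp_mul_left
    (fun x : ℝ => ((Real.sinc x ^ 2 : ℝ) : ℂ) * Complex.exp (u * x * Complex.I)) (2 * Real.pi)
  have heq : ∫ v : ℝ, Complex.exp (((2 * Real.pi * inner ℝ v u : ℝ) : ℂ) * Complex.I) •
      ((Real.sinc (2 * Real.pi * v) ^ 2 : ℝ) : ℂ) = ∫ x : ℝ,
      ((Real.sinc (2 * Real.pi * x) ^ 2 : ℝ) : ℂ) *
        Complex.exp (u * ((2 * Real.pi * x : ℝ) : ℂ) * Complex.I) := by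
    refine integral_congr_ae (Eventually.of_forall fun t => ?_)
    simp only [smul_eq_mul]
    rw [mul_comm]
    congr 3
    simp
    ring
  rw [heq, hsub, hg, abs_of_pos (by positivity), Complex.real_smul] at hinv
  have hpi' : ((2 * Real.pi : ℝ) : ℂ) ≠ 0 := by exact_mod_cast hpi
  rw [Complex.ofReal_inv, inv_mul_eq_iff_eq_mul₀ hpi'] at hinv
  rw [hinv]
  push_cast
  ring

/-- Jordan's inequality `sin x ≥ 2 x / π`, together with `π ≤ 4`. It allows division by `sinc²` on
`[-1, 1]`. -/
lemma half_le_sinc {x : ℝ} (hx : |x| ≤ 1) : 1 / 2 ≤ Real.sinc x := by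
  wlog h : 0 ≤ x generalizing x
  · rw [← Real.sinc_neg]
    exact this (by rwa [abs_neg]) (by linarith)
  rcases h.eq_or_lt with rfl | h
  · norm_num
  rw [abs_of_pos h] at hx
  rw [Real.sinc_of_ne_zero h.ne', le_div_iff₀ h]
  have h1 := Real.mul_le_sin h.le (by linarith [Real.pi_gt_three])
  refine le_trans (mul_le_mul_of_nonneg_right ?_ h.le) h1
  rw [div_le_div_iff₀ (by norm_num) Real.pi_pos]
  linarith [Real.pi_le_four]

/-! ### Weak convergence of finite measures -/

/-- **Lévy's continuity theorem** for finite measures with nonzero limit. -/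
theorem MeasureTheory.FiniteMeasure.tendsto_of_tendsto_charFun {μs : ℕ → FiniteMeasure ℝ}
    {μ : FiniteMeasure ℝ} (hμ : μ ≠ 0)
    (h : ∀ t : ℝ, Tendsto (fun n => charFun (μs n : Measure ℝ) t) atTop
      (𝓝 (charFun (μ : Measure ℝ) t))) :
    Tendsto μs atTop (𝓝 μ) := by
  -- The value of the characteristic function at `0` is the mass; its convergence reduces the claim
  -- to normalized measures, which requires a nonzero limit.
  have hmass : Tendsto (fun n => (μs n).mass) atTop (𝓝 μ.mass) := by
    have h0 := (Complex.continuous_re.tendsto _).comp (h 0)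
    simp only [charFun_zero, Function.comp_def, Complex.ofReal_re] at h0
    rw [← NNReal.tendsto_coe]
    exact h0
  have hmass0 : μ.mass ≠ 0 := (FiniteMeasure.mass_nonzero_iff μ).2 hμ
  have hchar : ∀ ν : FiniteMeasure ℝ, ν ≠ 0 → ∀ t,
      charFun (ν.normalize : Measure ℝ) t = (ν.mass : ℂ)⁻¹ * charFun (ν : Measure ℝ) t := by
    intro ν hν t
    rw [FiniteMeasure.toMeasure_normalize_eq_of_nonzero ν hν, charFun_apply, charFun_apply,
      integral_smul_nnreal_measure, NNReal.smul_def, Complex.real_smul]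
    push_cast
    rfl
  refine FiniteMeasure.tendsto_of_tendsto_normalize_testAgainstNN_of_tendsto_mass ?_ hmass
  refine ProbabilityMeasure.tendsto_of_tendsto_charFun fun t => ?_
  rw [hchar μ hμ]
  have hm : Tendsto (fun n => ((μs n).mass : ℂ)⁻¹) atTop (𝓝 ((μ.mass : ℂ)⁻¹)) := by
    refine Tendsto.inv₀ ?_ (by exact_mod_cast hmass0)
    exact (Complex.continuous_ofReal.tendsto _).comp (NNReal.tendsto_coe.2 hmass)
  refine (hm.mul (h t)).congr' ?_
  filter_upwards [hmass.eventually_ne hmass0] with n hn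
  rw [hchar _ ((FiniteMeasure.mass_nonzero_iff _).1 hn)]

/-- The finite measure with a bounded continuous density with respect to a finite measure. -/
noncomputable def MeasureTheory.FiniteMeasure.withBoundedDensity (μ : FiniteMeasure ℝ)
    (f : ℝ →ᵇ ℝ≥0) : FiniteMeasure ℝ :=
  ⟨(μ : Measure ℝ).withDensity fun x => f x,
    isFiniteMeasure_withDensity (BoundedContinuousFunction.lintegral_lt_top_of_nnreal _ f).ne⟩

theorem MeasureTheory.FiniteMeasure.tendsto_withBoundedDensity {μs : ℕ → FiniteMeasure ℝ}
    {μ : FiniteMeasure ℝ} (h : Tendsto μs atTop (𝓝 μ)) (f : ℝ →ᵇ ℝ≥0) :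
    Tendsto (fun n => (μs n).withBoundedDensity f) atTop (𝓝 (μ.withBoundedDensity f)) := by
  rw [FiniteMeasure.tendsto_iff_forall_lintegral_tendsto] at h ⊢
  intro g
  have hint : ∀ ν : FiniteMeasure ℝ, ∫⁻ x, (g x : ℝ≥0∞) ∂(ν.withBoundedDensity f : Measure ℝ) =
      ∫⁻ x, ((f * g) x : ℝ≥0) ∂(ν : Measure ℝ) := by
    intro ν
    refine (lintegral_withDensity_eq_lintegral_mul _ ?_ ?_).trans ?_
    · exact f.continuous.measurable.coe_nnreal_ennreal
    · exact g.continuous.measurable.coe_nnreal_ennreal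
    · simp
  simp only [hint]
  exact h (f * g)

theorem MeasureTheory.FiniteMeasure.tendsto_measure_of_null_frontier_of_tendsto
    {μs : ℕ → FiniteMeasure ℝ} {μ : FiniteMeasure ℝ} (hμ : μ ≠ 0) (h : Tendsto μs atTop (𝓝 μ))
    {E : Set ℝ} (hE : (μ : Measure ℝ) (frontier E) = 0) :
    Tendsto (fun n => μs n E) atTop (𝓝 (μ E)) := by
  have hE' : μ.normalize (frontier E) = 0 := by
    have h0 : μ (frontier E) = 0 := congrArg ENNReal.toNNReal hE
    rw [FiniteMeasure.normalize_eq_of_nonzero _ hμ, h0, mul_zero]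
  have h1 := ProbabilityMeasure.tendsto_measure_of_null_frontier_of_tendsto
    (FiniteMeasure.tendsto_normalize_of_tendsto h hμ) hE'
  have h2 := h.mass.mul h1
  simp only [← FiniteMeasure.self_eq_mass_mul_normalize] at h2
  exact h2

/-! ### Weighting by `sinc²` and removing the weight -/

/-- The square of the cardinal sine, as a bounded continuous function. -/
noncomputable def sincSq : ℝ →ᵇ ℝ≥0 :=
  BoundedContinuousFunction.mkOfBound
    ⟨fun x => ⟨Real.sinc x ^ 2, sq_nonneg _⟩, (Real.continuous_sinc.pow 2).subtype_mk _⟩ 1 (by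
      intro x y
      have hle : ∀ z, Real.sinc z ^ 2 ≤ 1 := fun z =>
        (sq_le_one_iff_abs_le_one _).2 (Real.abs_sinc_le_one z)
      rw [NNReal.dist_eq, abs_le]
      constructor
      · change -1 ≤ Real.sinc x ^ 2 - Real.sinc y ^ 2
        linarith [hle y, sq_nonneg (Real.sinc x)]
      · change Real.sinc x ^ 2 - Real.sinc y ^ 2 ≤ 1
        linarith [hle x, sq_nonneg (Real.sinc y)])

lemma coe_sincSq (x : ℝ) : (sincSq x : ℝ) = Real.sinc x ^ 2 := rfl

/-- A bounded continuous function which is the inverse of `sincSq` on `[-1, 1]`. -/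
noncomputable def invSincSq : ℝ →ᵇ ℝ≥0 :=
  BoundedContinuousFunction.mkOfBound
    ⟨fun x => (max (sincSq x) (1 / 4))⁻¹, (sincSq.continuous.max continuous_const).inv₀
      fun x => (lt_of_lt_of_le (by norm_num) (le_max_right _ _)).ne'⟩ 4 (by
      intro x y
      have hle : ∀ z, (((max (sincSq z) (1 / 4))⁻¹ : ℝ≥0) : ℝ) ≤ 4 := fun z => by
        have h : (1 / 4 : ℝ) ≤ ((max (sincSq z) (1 / 4) : ℝ≥0) : ℝ) := by
          rw [NNReal.coe_max]; simp
        rw [NNReal.coe_inv]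
        refine (inv_anti₀ (by norm_num) h).trans (by norm_num)
      rw [NNReal.dist_eq, abs_le]
      have hx := hle x
      have hy := hle y
      have hx0 := NNReal.coe_nonneg (max (sincSq x) (1 / 4))⁻¹
      have hy0 := NNReal.coe_nonneg (max (sincSq y) (1 / 4))⁻¹
      constructor
      · exact (by linarith : (-4 : ℝ) ≤ ((max (sincSq x) (1 / 4))⁻¹ : ℝ≥0) -
          ((max (sincSq y) (1 / 4))⁻¹ : ℝ≥0))
      · exact (by linarith : (((max (sincSq x) (1 / 4))⁻¹ : ℝ≥0) -
          ((max (sincSq y) (1 / 4))⁻¹ : ℝ≥0) : ℝ) ≤ 4))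

lemma sincSq_mul_invSincSq {x : ℝ} (hx : |x| ≤ 1) : sincSq x * invSincSq x = 1 := by
  have h : (1 / 4 : ℝ≥0) ≤ sincSq x := by
    rw [← NNReal.coe_le_coe, coe_sincSq]
    have := half_le_sinc hx
    push_cast
    nlinarith
  change sincSq x * (max (sincSq x) (1 / 4))⁻¹ = 1
  rw [max_eq_left h]
  exact mul_inv_cancel₀ (lt_of_lt_of_le (by norm_num) h).ne'

lemma withDensity_sincSq_invSincSq_apply (μ : Measure ℝ) {B : Set ℝ} (hB : MeasurableSet B)
    (hB1 : ∀ x ∈ B, |x| ≤ 1) :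
    (μ.withDensity fun x => sincSq x).withDensity (fun x => invSincSq x) B = μ B := by
  rw [← withDensity_mul _ sincSq.continuous.measurable.coe_nnreal_ennreal
    invSincSq.continuous.measurable.coe_nnreal_ennreal, withDensity_apply _ hB,
    setLIntegral_congr_fun hB (g := fun _ => 1), setLIntegral_one]
  intro x hx
  simp only [Pi.mul_apply]
  exact_mod_cast sincSq_mul_invSincSq (hB1 x hx)

lemma charFun_smul_withDensity_sincSq (μ : Measure ℝ) (k : ℝ≥0) (u : ℝ) :
    charFun ((k • μ).withDensity fun x => sincSq x) u =
      k * ∫ x, (Real.sinc x ^ 2 : ℝ) * Complex.exp (u * x * Complex.I) ∂μ := by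
  rw [charFun_apply_real, integral_withDensity_eq_integral_toReal_smul
    sincSq.continuous.measurable.coe_nnreal_ennreal (by simp), integral_smul_nnreal_measure,
    NNReal.smul_def, Complex.real_smul]
  simp [coe_sincSq]

/-- The limit measure `k * sinc ^ 2` of the weighted laws. -/
noncomputable def sincSqMeasure (k : ℝ≥0) : FiniteMeasure ℝ :=
  ⟨(k • (volume : Measure ℝ)).withDensity fun x => sincSq x, by
    refine isFiniteMeasure_withDensity ?_
    rw [← Measure.coe_nnreal_smul, lintegral_smul_measure]
    refine ENNReal.mul_ne_top ENNReal.coe_ne_top ?_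
    refine (lintegral_congr fun x => ?_).trans_ne integrable_sinc_sq.lintegral_lt_top.ne
    rw [← coe_sincSq, ENNReal.ofReal_coe_nnreal]⟩

/-- On `[-1, 1]` the two densities cancel, leaving mass `2 * k`. Nonvanishing is what normalization
needs in the portmanteau step. -/
lemma withBoundedDensity_sincSqMeasure_ne_zero {k : ℝ≥0} (hk : k ≠ 0) :
    (sincSqMeasure k).withBoundedDensity invSincSq ≠ 0 := by
  intro h
  have h1 : ((sincSqMeasure k).withBoundedDensity invSincSq : Measure ℝ) (Set.Icc (-1) 1) = 0 := by
    rw [h]; simp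
  have h2 := withDensity_sincSq_invSincSq_apply (k • volume) (measurableSet_Icc (a := (-1 : ℝ)) (b := 1))
    fun x hx => abs_le.2 hx
  have h3 := h2.symm.trans h1
  rw [Measure.smul_apply, Real.volume_Icc] at h3
  norm_num [hk, ENNReal.smul_def] at h3

lemma sincSqMeasure_ne_zero {k : ℝ≥0} (hk : k ≠ 0) : sincSqMeasure k ≠ 0 := by
  intro h
  refine withBoundedDensity_sincSqMeasure_ne_zero hk (Subtype.ext ?_)
  rw [h]
  exact withDensity_zero_left _

/-- Vague convergence towards Lebesgue measure, from the convergence of the Fourier transforms of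
the laws weighted by `sinc ^ 2`. -/
theorem tendsto_mul_measureReal_of_tendsto_integral_sinc {Q : ℕ → Measure ℝ}
    [∀ n, IsProbabilityMeasure (Q n)] {r : ℕ → ℝ} (hr : ∀ᶠ n in atTop, 0 ≤ r n) {c : ℝ} (hc : 0 < c)
    (h : ∀ u : ℝ, Tendsto (fun n => (r n : ℂ) *
      ∫ x, (Real.sinc x ^ 2 : ℝ) * Complex.exp (u * x * Complex.I) ∂(Q n)) atTop
      (𝓝 ((c * (2 * Real.pi * tent u) : ℝ) : ℂ)))
    {B : Set ℝ} (hB : MeasurableSet B) (hB1 : ∀ x ∈ B, |x| ≤ 1) (hfr : volume (frontier B) = 0) :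
    Tendsto (fun n => r n * (Q n).real B) atTop (𝓝 (c * volume.real B)) := by
  set k : ℝ≥0 := ⟨c, hc.le⟩ with hk
  have hk0 : k ≠ 0 := fun h0 => hc.ne' (congrArg NNReal.toReal h0)
  set M : ℕ → FiniteMeasure ℝ := fun n =>
    FiniteMeasure.withBoundedDensity ((r n).toNNReal • ⟨Q n, inferInstance⟩) sincSq with hM
  have hMlim : Tendsto M atTop (𝓝 (sincSqMeasure k)) := by
    refine FiniteMeasure.tendsto_of_tendsto_charFun (sincSqMeasure_ne_zero hk0) fun u => ?_
    have hlim : charFun (sincSqMeasure k : Measure ℝ) u =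
        ((c * (2 * Real.pi * tent u) : ℝ) : ℂ) := by
      refine (charFun_smul_withDensity_sincSq volume k u).trans ?_
      rw [integral_exp_mul_sinc_sq, Complex.ofReal_mul c]
      rfl
    rw [hlim]
    refine (h u).congr' ?_
    filter_upwards [hr] with n hn
    refine Eq.trans ?_ (charFun_smul_withDensity_sincSq (Q n) (r n).toNNReal u).symm
    rw [Real.coe_toNNReal _ hn]
  have hfr' : ((sincSqMeasure k).withBoundedDensity invSincSq : Measure ℝ) (frontier B) = 0 := by
    refine withDensity_absolutelyContinuous _ _ (withDensity_absolutelyContinuous _ _ ?_)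
    rw [Measure.smul_apply, hfr, smul_zero]
  have h2 := FiniteMeasure.tendsto_measure_of_null_frontier_of_tendsto
    (withBoundedDensity_sincSqMeasure_ne_zero hk0)
    (FiniteMeasure.tendsto_withBoundedDensity hMlim invSincSq) hfr'
  rw [← NNReal.tendsto_coe] at h2
  have hl : (((sincSqMeasure k).withBoundedDensity invSincSq B : ℝ≥0) : ℝ) = c * volume.real B := by
    refine (congrArg ENNReal.toReal (withDensity_sincSq_invSincSq_apply (k • volume) hB hB1)).trans ?_
    rw [Measure.smul_apply, ENNReal.smul_def, smul_eq_mul, ENNReal.toReal_mul]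
    rfl
  rw [hl] at h2
  refine h2.congr' ?_
  filter_upwards [hr] with n hn
  refine (congrArg ENNReal.toReal
    (withDensity_sincSq_invSincSq_apply ((r n).toNNReal • Q n) hB hB1)).trans ?_
  rw [Measure.smul_apply, ENNReal.smul_def, smul_eq_mul, ENNReal.toReal_mul, ENNReal.coe_toReal,
    Real.coe_toNNReal _ hn]
  rfl

/-! ### Parseval and the local limit theorem -/

/-- Parseval's identity for the tent function. -/
lemma integral_sinc_sq_mul_exp (Q : Measure ℝ) [IsProbabilityMeasure Q] (u : ℝ) :
    ∫ x, (Real.sinc x ^ 2 : ℝ) * Complex.exp (u * x * Complex.I) ∂Q =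
      ∫ v, (tent (v - u) : ℂ) * charFun Q v := by
  have h1 : ∀ x : ℝ, ((Real.sinc x ^ 2 : ℝ) : ℂ) * Complex.exp (u * x * Complex.I) =
      ∫ t, (tent t : ℂ) * Complex.exp ((t + u : ℝ) * x * Complex.I) := by
    intro x
    rw [← integral_tent_mul_exp, ← integral_mul_const]
    refine integral_congr_ae (Eventually.of_forall fun t => ?_)
    simp only
    rw [mul_assoc, ← Complex.exp_add]
    congr 2
    push_cast
    ring
  simp only [h1]
  rw [integral_integral_swap]
  · rw [← integral_sub_right_eq_self _ u]
    refine integral_congr_ae (Eventually.of_forall fun v => ?_)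
    simp only [sub_add_cancel]
    rw [integral_const_mul, charFun_apply_real]
  -- Fubini is justified by the majorant `|tent|`, integrable since `Q` is finite.
  · have hi : Integrable (fun z : ℝ × ℝ => (tent z.2 : ℂ)) (Q.prod volume) :=
      (integrable_tent.ofReal (𝕜 := ℂ)).comp_snd Q
    refine (hi.bdd_mul (c := 1) (f := fun z : ℝ × ℝ =>
      Complex.exp ((z.2 + u : ℝ) * z.1 * Complex.I)) ?_ ?_).congr ?_
    · exact Continuous.aestronglyMeasurable (by fun_prop)
    · refine Eventually.of_forall fun z => ?_
      rw [← Complex.ofReal_mul, Complex.norm_exp_ofReal_mul_I]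
    · exact Eventually.of_forall fun z => mul_comm _ _

lemma stableConst_pos {p : ℝ} (hp : 0 < p) : 0 < stableConst p := by
  have hi : Integrable fun s : ℝ => Real.exp (-(|s| ^ p)) := by
    simpa using integrable_exp_neg_mul_abs_rpow one_pos hp
  exact mul_pos (by positivity) (integral_exp_pos hi)

namespace IsStableNorming

variable {φ : ℝ → ℝ} {b : ℕ → ℝ} {p : ℝ}

/-- The local limit theorem for subsets of `[-1, 1]`. -/
theorem tendsto_mul_measureReal_of_abs_le_one (h : IsStableNorming φ b p) {Q : ℕ → Measure ℝ}
    [∀ n, IsProbabilityMeasure (Q n)] {τ : ℕ → ℝ} (hτ : ∀ᶠ n in atTop, 1 ≤ τ n)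
    (hbτ : Tendsto (fun n => b n / τ n) atTop atTop)
    (hQ : ∀ n t, charFun (Q n) t = ((φ (t / τ n) ^ n : ℝ) : ℂ))
    {B : Set ℝ} (hB : MeasurableSet B) (hB1 : ∀ x ∈ B, |x| ≤ 1) (hfr : volume (frontier B) = 0) :
    Tendsto (fun n => b n / τ n * (Q n).real B) atTop (𝓝 (stableConst p * volume.real B)) := by
  refine tendsto_mul_measureReal_of_tendsto_integral_sinc (hbτ.eventually_ge_atTop 0)
    (stableConst_pos h.p_pos) (fun u => ?_) hB hB1 hfr
  have hlim := h.tendsto_integral_mul_pow (G := fun v => tent (v - u))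
    (continuous_tent.comp (continuous_id.sub continuous_const)) (A := 2 + |u|) (by positivity)
    (fun v hv => tent_eq_zero (by linarith [abs_sub_abs_le_abs_sub v u])) hτ hbτ
  have hval : tent (0 - u) * ∫ s, Real.exp (-(|s| ^ p)) = stableConst p * (2 * Real.pi * tent u) := by
    rw [zero_sub, tent_neg, stableConst]
    have := Real.pi_pos
    field_simp
  rw [hval] at hlim
  refine ((Complex.continuous_ofReal.tendsto _).comp hlim).congr' ?_
  filter_upwards [hτ, hbτ.eventually_gt_atTop 0] with n hn hr
  rw [integral_sinc_sq_mul_exp]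
  simp only [hQ]
  have hcomp := Measure.integral_comp_div
    (fun v => ((tent (v - u) : ℝ) : ℂ) * ((φ (v / τ n) ^ n : ℝ) : ℂ)) (b n / τ n)
  rw [abs_of_pos hr, Complex.real_smul] at hcomp
  rw [← hcomp, Function.comp_apply, ← integral_complex_ofReal]
  refine integral_congr_ae (Eventually.of_forall fun s => ?_)
  simp only
  rw [show s / (b n / τ n) / τ n = s / b n by
    have : τ n ≠ 0 := by linarith
    field_simp]
  push_cast
  rfl

/-- The local limit theorem at an intermediate scale `τ`. -/
theorem tendsto_mul_measureReal (h : IsStableNorming φ b p) {Ω : Type*} [MeasurableSpace Ω]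
    {P : Measure Ω} [IsProbabilityMeasure P] {S : ℕ → Ω → ℝ} (hS : ∀ n, Measurable (S n))
    (hSφ : ∀ n t, charFun (P.map (S n)) t = ((φ t ^ n : ℝ) : ℂ))
    {τ : ℕ → ℝ} (hτ : ∀ᶠ n in atTop, 1 ≤ τ n)
    (hbτ : Tendsto (fun n => b n / τ n) atTop atTop)
    {B : Set ℝ} (hB : MeasurableSet B) (hBJ : IsBoundedJordanMeasurable B) :
    Tendsto (fun n => b n / τ n * P.real {ω | S n ω / τ n ∈ B}) atTop
      (𝓝 (stableConst p * volume.real B)) := by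
  obtain ⟨R, hR⟩ := isBounded_iff_forall_norm_le.1 hBJ.1
  -- Dilation by `L ≥ R` brings `B` into `[-1, 1]`, and `L ≥ 1` preserves `1 ≤ L * τ n`. The factors
  -- `L⁻¹` in the norming and in the volume cancel.
  set L : ℝ := max R 1 with hL
  have hL1 : 1 ≤ L := le_max_right _ _
  have hL0 : 0 < L := by linarith
  set e : ℝ ≃ₜ ℝ := Homeomorph.mulLeft₀ L hL0.ne' with he
  have hmeas : ∀ n, Measurable fun ω => (L * τ n)⁻¹ * S n ω := fun n => (hS n).const_mul _
  have hprob : ∀ n, IsProbabilityMeasure (P.map fun ω => (L * τ n)⁻¹ * S n ω) :=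
    fun n => Measure.isProbabilityMeasure_map (hmeas n).aemeasurable
  have key := h.tendsto_mul_measureReal_of_abs_le_one
    (Q := fun n => P.map fun ω => (L * τ n)⁻¹ * S n ω) (τ := fun n => L * τ n) (B := e ⁻¹' B)
    ?_ ?_ ?_ (e.continuous.measurable hB) ?_ ?_
  · have hvol : volume.real (e ⁻¹' B) = L⁻¹ * volume.real B := by
      rw [Measure.real, Measure.real]
      have := Real.volume_preimage_mul_left hL0.ne' B
      rw [show e ⁻¹' B = (L * ·) ⁻¹' B from rfl, this, ENNReal.toReal_mul,
        ENNReal.toReal_ofReal (abs_nonneg _), abs_of_pos (inv_pos.2 hL0)]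
    have key2 := key.const_mul L
    rw [hvol, show L * (stableConst p * (L⁻¹ * volume.real B)) = stableConst p * volume.real B by
      field_simp] at key2
    refine key2.congr fun n => ?_
    rw [map_measureReal_apply (hmeas n) (e.continuous.measurable hB)]
    have hset : (fun ω => (L * τ n)⁻¹ * S n ω) ⁻¹' (e ⁻¹' B) = {ω | S n ω / τ n ∈ B} := by
      ext ω
      change L * ((L * τ n)⁻¹ * S n ω) ∈ B ↔ S n ω / τ n ∈ B
      rw [mul_inv, div_eq_inv_mul, ← mul_assoc, mul_inv_cancel_left₀ hL0.ne']
    rw [hset, ← mul_assoc, ← div_div, div_right_comm, mul_div_cancel₀ _ hL0.ne']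
  · filter_upwards [hτ] with n hn
    nlinarith
  · refine (hbτ.const_mul_atTop (inv_pos.2 hL0)).congr fun n => ?_
    rw [← div_eq_inv_mul, div_div, mul_comm]
  · intro n t
    rw [charFun_map_mul_comp (hS n).aemeasurable, hSφ, div_eq_inv_mul]
  · intro x hx
    have : |L * x| ≤ R := hR _ hx
    rw [abs_mul, abs_of_pos hL0] at this
    have hRL : R ≤ L := le_max_left _ _
    nlinarith
  · rw [← e.preimage_frontier, show e ⁻¹' frontier B = (L * ·) ⁻¹' frontier B from rfl,
      Real.volume_preimage_mul_left hL0.ne', hBJ.2, mul_zero]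

end IsStableNorming

/-! ### From convergence in law to the norming properties -/

/-- Convergence in distribution implies convergence of the characteristic functions along
convergent arguments. -/
lemma MeasureTheory.TendstoInDistribution.tendsto_charFun_prod {Ω Ω' : Type*} [MeasurableSpace Ω]
    [MeasurableSpace Ω'] {P : Measure Ω} [IsProbabilityMeasure P] {P' : Measure Ω'}
    [IsProbabilityMeasure P'] {Y : ℕ → Ω → ℝ} {Z : Ω' → ℝ}
    (h : TendstoInDistribution Y atTop Z (fun _ => P) P') (x : ℝ) :
    Tendsto (fun y : ℕ × ℝ => charFun (P.map (Y y.1)) y.2) (atTop ×ˢ 𝓝 x)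
      (𝓝 (charFun (P'.map Z) x)) := by
  have h1 : TendstoInDistribution (fun y : ℕ × ℝ => Y y.1) (atTop ×ˢ 𝓝 x) Z (fun _ => P) P' :=
    ⟨fun y => h.forall_aemeasurable y.1, h.aemeasurable_limit, h.tendsto.comp tendsto_fst⟩
  have h2 : TendstoInMeasure P (fun (y : ℕ × ℝ) (_ : Ω) => y.2) (atTop ×ˢ 𝓝 x) fun _ => x := by
    intro ε hε
    refine tendsto_const_nhds.congr' ?_
    filter_upwards [tendsto_snd.eventually (Metric.eball_mem_nhds x hε)] with y hy
    have hy' : edist y.2 x < ε := hy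
    simp [hy'.not_ge]
  -- Slutsky: as `n → ∞` and `y → x` jointly, `y * Y n` converges in law to `x * Z`. The
  -- characteristic function of `Y n` at `y` is that of `y * Y n` at `1`.
  have h3 := h1.continuous_comp_prodMk_of_tendstoInMeasure_const
    (g := fun z : ℝ × ℝ => z.2 * z.1) (by fun_prop) h2 (fun _ => aemeasurable_const)
  have h5 := (ProbabilityMeasure.tendsto_iff_forall_integral_rclike_tendsto ℂ).1 h3.tendsto
    (BoundedContinuousFunction.innerProbChar 1)
  simp only [ProbabilityMeasure.coe_mk, ← charFun_eq_integral_innerProbChar] at h5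
  rw [charFun_map_mul_comp h.aemeasurable_limit, mul_one] at h5
  refine h5.congr fun y => ?_
  rw [charFun_map_mul_comp (h.forall_aemeasurable y.1), mul_one]

section Symmetric

variable {μ : Measure ℝ} [IsProbabilityMeasure μ]

/-- Symmetry makes the characteristic function equal to its conjugate, hence to its real part. -/
lemma charFun_eq_integral_cos (hμ : μ.map (fun x => -x) = μ) (t : ℝ) :
    charFun μ t = ((∫ x, Real.cos (t * x) ∂μ : ℝ) : ℂ) := by
  have h1 : (starRingEnd ℂ) (charFun μ t) = charFun μ t := by
    rw [← charFun_neg]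
    conv_rhs => rw [← hμ]
    have := charFun_map_mul (μ := μ) (-1) t
    simp only [neg_mul, one_mul] at this
    exact this.symm
  rw [← Complex.conj_eq_iff_re.1 h1, charFun_apply_real]
  congr 1
  have hi : Integrable (fun x : ℝ => Complex.exp (t * x * Complex.I)) μ := by
    refine (integrable_const (1 : ℝ)).mono' (Continuous.aestronglyMeasurable (by fun_prop))
      (Eventually.of_forall fun x => ?_)
    rw [← Complex.ofReal_mul, Complex.norm_exp_ofReal_mul_I]
  have := integral_re hi
  simp only [RCLike.re_to_complex] at this
  rw [← this]
  refine integral_congr_ae (Eventually.of_forall fun x => ?_)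
  simp only
  rw [← Complex.ofReal_mul, Complex.exp_ofReal_mul_I_re]

lemma integrable_cos_mul (t : ℝ) : Integrable (fun x : ℝ => Real.cos (t * x)) μ :=
  (integrable_const (1 : ℝ)).mono' (Continuous.aestronglyMeasurable (by fun_prop))
    (Eventually.of_forall fun x => Real.abs_cos_le_one _)

/-- A real characteristic function of a law that is not lattice has modulus less than one away from
the origin. -/
lemma abs_integral_cos_lt_one (hμ : ¬ IsLatticeLaw μ) {t : ℝ} (ht : t ≠ 0) :
    |∫ x, Real.cos (t * x) ∂μ| < 1 := by
  have hd : 0 < 2 * Real.pi / |t| := by positivity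
  have hsgn : ∀ k : ℤ, ∃ m : ℤ, (k : ℝ) * (2 * Real.pi) / t = m * (2 * Real.pi / |t|) := by
    intro k
    rcases lt_or_gt_of_ne ht with h | h
    · refine ⟨-k, ?_⟩
      rw [abs_of_neg h]
      push_cast
      field_simp
    · refine ⟨k, ?_⟩
      rw [abs_of_pos h]
      ring
  have hzero : ∀ f : ℝ → ℝ, (∀ x, 0 ≤ f x) → Integrable f μ → ∫ x, f x ∂μ ≤ 0 →
      ∀ᵐ x ∂μ, f x = 0 := fun f hf0 hfi hle =>
    (integral_eq_zero_iff_of_nonneg hf0 hfi).1 (le_antisymm hle (integral_nonneg hf0))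
  rw [abs_lt]
  constructor
  -- Equality forces `cos (t * x) = -1` almost everywhere, so `x` lies in `π / t + (2 * π / |t|) ℤ`;
  -- the other case, `cos (t * x) = 1`, gives the same progression based at `0`.
  · by_contra! hcon
    refine hμ ⟨Real.pi / t, 2 * Real.pi / |t|, hd, ?_⟩
    have h0 := hzero (fun x => 1 + Real.cos (t * x))
      (fun x => by linarith [Real.neg_one_le_cos (t * x)])
      ((integrable_const 1).add (integrable_cos_mul t)) (by
        rw [integral_add (integrable_const 1) (integrable_cos_mul t)]
        simpa using by linarith)
    filter_upwards [h0] with x hx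
    obtain ⟨k, hk⟩ := Real.cos_eq_neg_one_iff.1 (show Real.cos (t * x) = -1 by linarith)
    obtain ⟨m, hm⟩ := hsgn k
    refine ⟨m, ?_⟩
    rw [← hm]
    field_simp
    linarith
  · by_contra! hcon
    refine hμ ⟨0, 2 * Real.pi / |t|, hd, ?_⟩
    have h0 := hzero (fun x => 1 - Real.cos (t * x))
      (fun x => by linarith [Real.cos_le_one (t * x)])
      ((integrable_const 1).sub (integrable_cos_mul t)) (by
        rw [integral_sub (integrable_const 1) (integrable_cos_mul t)]
        simpa using by linarith)
    filter_upwards [h0] with x hx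
    obtain ⟨k, hk⟩ := (Real.cos_eq_one_iff _).1 (show Real.cos (t * x) = 1 by linarith)
    obtain ⟨m, hm⟩ := hsgn k
    refine ⟨m, ?_⟩
    rw [← hm, zero_add]
    field_simp
    linarith

end Symmetric

/-- The norming sequence of a convergence in distribution to a symmetric stable law. -/
theorem isStableNorming_of_tendstoInDistribution {Ω : Type*} [MeasurableSpace Ω] {P : Measure Ω}
    [IsProbabilityMeasure P] {μ : Measure ℝ} [IsProbabilityMeasure μ]
    (hsymm : μ.map (fun x => -x) = μ) (hlattice : ¬ IsLatticeLaw μ)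
    {S : ℕ → Ω → ℝ} (hS : ∀ n, Measurable (S n))
    (hSμ : ∀ n t, charFun (P.map (S n)) t = charFun μ t ^ n) {p : ℝ} (hp0 : 0 < p) (hp2 : p ≤ 2)
    {ν : Measure ℝ} [IsProbabilityMeasure ν]
    (hν : ∀ t : ℝ, charFun ν t = (Real.exp (-(|t| ^ p)) : ℂ))
    {b : ℕ → ℝ} (hb : ∀ n, 1 ≤ n → 0 < b n)
    (hconv : TendstoInDistribution (fun n ω => S n ω / b n) atTop (fun x : ℝ => x) (fun _ => P) ν) :
    IsStableNorming (fun t => ∫ x, Real.cos (t * x) ∂μ) b p := by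
  have hcharFun := charFun_eq_integral_cos hsymm
  refine ⟨hp0, hp2, ?_, ?_, ?_, ?_, fun t ht => abs_integral_cos_lt_one hlattice ht, hb, ?_⟩
  · have : (fun t => ∫ x, Real.cos (t * x) ∂μ) = fun t => (charFun μ t).re := by
      ext t; rw [hcharFun, Complex.ofReal_re]
    rw [this]
    exact Complex.continuous_re.comp continuous_charFun
  · intro t
    refine integral_congr_ae (Eventually.of_forall fun x => ?_)
    simp only
    rw [← Real.cos_abs (t * x), ← Real.cos_abs (|t| * x), abs_mul, abs_mul, abs_abs]
  · simp
  · intro t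
    have := norm_charFun_le_one (μ := μ) t
    rwa [hcharFun, Complex.norm_real] at this
  · intro A
    have hcont : Continuous fun t : ℝ => Real.exp (-(|t| ^ p)) :=
      Real.continuous_exp.comp ((continuous_abs.rpow_const fun _ => Or.inr hp0.le).neg)
    refine (tendstoLocallyUniformlyOn_iff_tendstoUniformlyOn_of_compact isCompact_Icc).1
      (TendstoLocallyUniformly.tendstoLocallyUniformlyOn ?_)
    -- Locally uniform convergence is convergence along `atTop ×ˢ 𝓝 x` for each `x`, the form that
    -- the Slutsky argument provides.
    rw [tendstoLocallyUniformly_iff_forall_tendsto]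
    intro x
    have h1 := (Complex.continuous_re.tendsto _).comp (hconv.tendsto_charFun_prod x)
    rw [Measure.map_id', hν, Complex.ofReal_re] at h1
    have h2 := ((hcont.tendsto x).comp (tendsto_snd (f := atTop (α := ℕ)))).prodMk_nhds h1
    refine (h2.mono_right (nhds_le_uniformity _)).congr fun y => ?_
    have h3 : charFun (P.map fun ω => S y.1 ω / b y.1) y.2 =
        (((∫ x, Real.cos (y.2 / b y.1 * x) ∂μ) ^ y.1 : ℝ) : ℂ) := by
      simp only [div_eq_inv_mul]
      rw [charFun_map_mul_comp (hS y.1).aemeasurable, hSμ, hcharFun, Complex.ofReal_pow]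
    simp only [Function.comp_apply]
    rw [h3, Complex.ofReal_re]

theorem mainTheorem7 {Ω : Type*} [MeasurableSpace Ω] (P : Measure Ω) [IsProbabilityMeasure P]
    (X : ℕ → Ω → ℝ) (hXm : ∀ i, Measurable (X i))
    (hindep : iIndepFun X P) (hident : ∀ i, IdentDistrib (X i) (X 0) P P)
    (hsymm : IdentDistrib (fun ω => -X 0 ω) (X 0) P P)
    (hlattice : ¬ IsLatticeLaw (P.map (X 0)))
    (p : ℝ) (hp0 : 0 < p) (hp2 : p ≤ 2)
    (ν : Measure ℝ) [IsProbabilityMeasure ν]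
    (hν : ∀ t : ℝ, charFun ν t = (Real.exp (-(|t| ^ p)) : ℂ))
    (b : ℕ → ℝ) (hb : ∀ n, 1 ≤ n → 0 < b n)
    (hconv : TendstoInDistribution
      (fun (n : ℕ) (ω : Ω) => (∑ i ∈ Finset.range n, X i ω) / b n) atTop
      (fun x : ℝ => x) (fun _ => P) ν) :
    (∀ B : Set ℝ, MeasurableSet B → IsBoundedJordanMeasurable B →
      Tendsto (fun n : ℕ => b n * P.real {ω | (∑ i ∈ Finset.range n, X i ω) ∈ B}) atTop
        (𝓝 (stableConst p * volume.real B))) ∧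
    (∀ τ : ℕ → ℝ, (∀ n, 1 ≤ n → 0 < τ n) → Tendsto τ atTop atTop →
      Tendsto (fun n => b n / τ n) atTop atTop →
      ∀ B : Set ℝ, MeasurableSet B → IsBoundedJordanMeasurable B →
        Tendsto (fun n : ℕ =>
            b n / τ n * P.real {ω | (∑ i ∈ Finset.range n, X i ω) / τ n ∈ B}) atTop
          (𝓝 (stableConst p * volume.real B))) := by
  set S : ℕ → Ω → ℝ := fun n ω => ∑ i ∈ Finset.range n, X i ω with hSdef
  have hS : ∀ n, Measurable (S n) := fun n => Finset.measurable_fun_sum _ fun i _ => hXm i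
  have : IsProbabilityMeasure (P.map (X 0)) :=
    Measure.isProbabilityMeasure_map (hXm 0).aemeasurable
  have hSμ : ∀ n t, charFun (P.map (S n)) t = charFun (P.map (X 0)) t ^ n := by
    intro n t
    rw [(hindep.restrict _).charFun_map_fun_finsetSum_eq_prod fun i _ => (hXm i).aemeasurable]
    simp [fun i => (hident i).map_eq]
  have hneg : (P.map (X 0)).map (fun x => -x) = P.map (X 0) := by
    rw [Measure.map_map measurable_neg (hXm 0)]
    exact hsymm.map_eq
  have h := isStableNorming_of_tendstoInDistribution hneg hlattice hS hSμ hp0 hp2 hν hb hconv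
  have hSφ : ∀ n t, charFun (P.map (S n)) t =
      (((∫ x, Real.cos (t * x) ∂(P.map (X 0))) ^ n : ℝ) : ℂ) := by
    intro n t
    rw [hSμ, charFun_eq_integral_cos hneg, Complex.ofReal_pow]
  refine ⟨fun B hB hBJ => ?_, fun τ _ hτ hbτ B hB hBJ =>
    h.tendsto_mul_measureReal hS hSφ (hτ.eventually_ge_atTop 1) hbτ hB hBJ⟩
  have := h.tendsto_mul_measureReal hS hSφ (τ := fun _ => 1) (Eventually.of_forall fun _ => le_rfl)
    (by simpa using h.tendsto_norming_atTop) hB hBJ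
  simpa using this
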